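/- Let $n\ge 2$, let $F_n$ be the free group of rank $n$, and let $\mathcal G_n$ be the space of $n$-generated marked groups: the set of pairs $(G,X)$, where $G$ is a group and $X=(x_1,\dots,x_n)\in G^n$ generates $G$, up to isomorphisms of groups that preserve the ordered generating tuples. Identify $(G,X)$ with the kernel of the homomorphism $F_n\to G$ that maps a fixed basis of $F_n$ to $X$; thus $\mathcal G_n$ is the set of normal subgroups of $F_n$, with the topology induced by the product topology on $2^{F_n}$. The natural action of $\operatorname{Aut}(F_n)$ on normal subgroups of $F_n$ induces an action of $\operatorname{Out}(F_n)$ on $\mathcal G_n$. A Borel probability measure $\mu$ on $\mathcal G_n$ is $\operatorname{Out}(F_n)$-invariant if $\mu(gA)=\mu(A)$ for all $g\in\operatorname{Out}(F_n)$ and all Borel $A\subseteq\mathcal G_n$; an invariant $\mu$ is ergodic if $\mu(A)\in\{0,1\}$ for every $\operatorname{Out}(F_n)$-invariant Borel set $A$. The support of $\mu$ is the set of all points every open neighbourhood of which has positive measure. Let $\mathcal H_n\subseteq\mathcal G_n$ be the set of all $(G,X)$ such that $G$ is (Gromov) hyperbolic and not virtually cyclic. Then there is no $\operatorname{Out}(F_n)$-invariant,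 ergodic Borel probability measure on $\mathcal G_n$ whose support contains $\mathcal H_n$. -/

import Mathlib

open scoped Pointwise

noncomputable section

/-- The free group `F_n` of rank `n`. -/
abbrev FreeGp (n : ℕ) : Type := FreeGroup (Fin n)

/-- The subgroup `Inn(G)` of inner automorphisms of `G`. -/
def innerAut (G : Type*) [Group G] : Subgroup (MulAut G) := (MulAut.conj (G := G)).range

instance innerAut_normal (G : Type*) [Group G] : (innerAut G).Normal := by
  constructor
  rintro _ ⟨g, rfl⟩ φ
  refine ⟨φ g, ?_⟩
  ext x
  simp [MulAut.conj_apply]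

/-- The outer automorphism group `Out(G) = Aut(G) / Inn(G)`. -/
abbrev OutAut (G : Type*) [Group G] : Type _ := MulAut G ⧸ innerAut G

/-- The space `𝒢_n` of `n`-generated marked groups up to isomorphism of marked groups, as the set of
normal subgroups of `F_n`. The marked group `(G, X)` is the point `MarkedGroupSpace.mk G X`, the
kernel of the homomorphism `F_n → G` that maps the basis of `F_n` to `X`
(see `MarkedGroupSpace.mk_eq_mk_iff` and `MarkedGroupSpace.exists_eq_mk`). -/
def MarkedGroupSpace (n : ℕ) : Type := {N : Subgroup (FreeGp n) // N.Normal}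

namespace MarkedGroupSpace

variable {n : ℕ}

/-- The point of `𝒢_n` represented by the group `G` with the tuple `X ∈ G^n`; it is meant for
tuples `X` that generate `G`. -/
def mk (G : Type*) [Group G] (X : Fin n → G) : MarkedGroupSpace n :=
  ⟨(FreeGroup.lift X).ker, inferInstance⟩

/-- The indicator function of a normal subgroup of `F_n`, a point of `2^{F_n}`. -/
def indicator (N : MarkedGroupSpace n) : FreeGp n → Bool :=
  fun w => open Classical in decide (w ∈ N.1)

/-- The topology on `𝒢_n` is induced by the product topology on `2^{F_n}` (with `Bool` discrete). -/
instance : TopologicalSpace (MarkedGroupSpace n) :=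
  TopologicalSpace.induced indicator inferInstance

instance : MeasurableSpace (MarkedGroupSpace n) := borel _

instance : BorelSpace (MarkedGroupSpace n) := ⟨rfl⟩

/-- The action of `Aut(F_n)` on `𝒢_n`: the automorphism `φ` maps `N` to its image `φ(N)`. -/
instance : MulAction (MulAut (FreeGp n)) (MarkedGroupSpace n) where
  smul φ N := ⟨N.1.map φ.toMonoidHom, N.2.map _ φ.surjective⟩
  one_smul N := Subtype.ext (Subgroup.map_id N.1)
  mul_smul φ ψ N := Subtype.ext (Subgroup.map_map N.1 φ.toMonoidHom ψ.toMonoidHom).symm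

theorem mem_smul_iff (φ : MulAut (FreeGp n)) (N : MarkedGroupSpace n) (w : FreeGp n) :
    w ∈ (φ • N).1 ↔ φ⁻¹ w ∈ N.1 := by
  change w ∈ N.1.map φ.toMonoidHom ↔ _
  rw [Subgroup.mem_map]
  constructor
  · rintro ⟨v, hv, rfl⟩
    simpa using hv
  · intro h
    exact ⟨φ⁻¹ w, h, by simp⟩

theorem conj_smul (g : FreeGp n) (N : MarkedGroupSpace n) : MulAut.conj g • N = N := by
  apply Subtype.ext
  ext w
  rw [mem_smul_iff, ← map_inv, MulAut.conj_apply]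
  exact N.2.mem_comm_iff.trans (by simp)

/-- The action of `Aut(F_n)` on `𝒢_n` as a homomorphism to the permutations of `𝒢_n`; it is trivial
on inner automorphisms and so factors through `Out(F_n)`. -/
def outToPerm (n : ℕ) : OutAut (FreeGp n) →* Equiv.Perm (MarkedGroupSpace n) :=
  QuotientGroup.lift (innerAut (FreeGp n))
    (MulAction.toPermHom (MulAut (FreeGp n)) (MarkedGroupSpace n)) (by
      rintro _ ⟨g, rfl⟩
      ext N : 1
      exact conj_smul g N)

/-- The action of `Out(F_n)` on `𝒢_n`. -/
instance : MulAction (OutAut (FreeGp n)) (MarkedGroupSpace n) :=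
  MulAction.compHom _ (outToPerm n)

/-- The class of `φ` in `Out(F_n)` acts as `φ` does. -/
theorem out_smul_eq (φ : MulAut (FreeGp n)) (N : MarkedGroupSpace n) :
    (QuotientGroup.mk φ : OutAut (FreeGp n)) • N = φ • N := rfl

/-- Two marked groups give the same point of `𝒢_n` exactly when they are isomorphic as marked
groups. -/
theorem mk_eq_mk_iff {G H : Type*} [Group G] [Group H] (X : Fin n → G) (Y : Fin n → H)
    (hX : Subgroup.closure (Set.range X) = ⊤) (hY : Subgroup.closure (Set.range Y) = ⊤) :
    mk G X = mk H Y ↔ ∃ e : G ≃* H, ∀ i, e (X i) = Y i := by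
  have hsX : Function.Surjective (FreeGroup.lift X) := by
    rw [← MonoidHom.range_eq_top, FreeGroup.range_lift_eq_closure, hX]
  have hsY : Function.Surjective (FreeGroup.lift Y) := by
    rw [← MonoidHom.range_eq_top, FreeGroup.range_lift_eq_closure, hY]
  constructor
  · intro h
    have hk : (FreeGroup.lift X).ker = (FreeGroup.lift Y).ker := congrArg Subtype.val h
    refine ⟨(QuotientGroup.quotientKerEquivOfSurjective _ hsX).symm.trans
      ((QuotientGroup.quotientMulEquivOfEq hk).trans
        (QuotientGroup.quotientKerEquivOfSurjective _ hsY)), fun i => ?_⟩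
    have h1 : (QuotientGroup.quotientKerEquivOfSurjective _ hsX).symm (X i)
        = QuotientGroup.mk (FreeGroup.of i) := by
      rw [MulEquiv.symm_apply_eq]
      exact (FreeGroup.lift_apply_of (f := X) (x := i)).symm
    rw [MulEquiv.trans_apply, h1]
    exact FreeGroup.lift_apply_of (f := Y) (x := i)
  · rintro ⟨e, he⟩
    have h : FreeGroup.lift Y = e.toMonoidHom.comp (FreeGroup.lift X) := by
      ext i
      simp [he]
    apply Subtype.ext
    change (FreeGroup.lift X).ker = (FreeGroup.lift Y).ker
    ext w
    rw [h]
    simp [MonoidHom.mem_ker]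

/-- Every point of `𝒢_n` is represented by a marked group. -/
theorem exists_eq_mk (N : MarkedGroupSpace n) :
    ∃ (G : Type) (_ : Group G) (X : Fin n → G),
      Subgroup.closure (Set.range X) = ⊤ ∧ N = mk G X := by
  obtain ⟨N, hN⟩ := N
  have h : FreeGroup.lift (fun i => (QuotientGroup.mk (FreeGroup.of i) : FreeGp n ⧸ N))
      = QuotientGroup.mk' N := by
    ext i
    simp
  refine ⟨FreeGp n ⧸ N, inferInstance, fun i => QuotientGroup.mk (FreeGroup.of i), ?_, ?_⟩
  · rw [← FreeGroup.range_lift_eq_closure, h, MonoidHom.range_eq_top]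
    exact QuotientGroup.mk'_surjective N
  · apply Subtype.ext
    change N = (FreeGroup.lift _).ker
    rw [h, QuotientGroup.ker_mk']

end MarkedGroupSpace

/-- Word distance on `G` with respect to `S`: the path metric on the vertices of the Cayley graph
`Cay(G, S)`. -/
def wordDist {G : Type*} [Group G] (S : Set G) (x y : G) : ℕ := (SimpleGraph.mulCayley S).dist x y

/-- A group `G` is (Gromov) hyperbolic if it has a finite generating set `S` whose word metric is
Gromov hyperbolic, i.e. satisfies the four-point condition for some constant `δ`. -/
def IsHyperbolicGroup (G : Type*) [Group G] : Prop :=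
  ∃ S : Set G, S.Finite ∧ Subgroup.closure S = ⊤ ∧ ∃ δ : ℕ, ∀ x y z w : G,
    wordDist S x y + wordDist S z w ≤
      max (wordDist S x z + wordDist S y w) (wordDist S x w + wordDist S y z) + δ

/-- A group is virtually cyclic if it has a cyclic subgroup of finite index. -/
def IsVirtuallyCyclicGroup (G : Type*) [Group G] : Prop :=
  ∃ C : Subgroup G, IsCyclic C ∧ C.FiniteIndex

/-- The set `ℋ_n` of all marked groups `(G, X)` in `𝒢_n` with `G` hyperbolic and not virtually
cyclic. -/
def hyperbolicMarkedGroups (n : ℕ) : Set (MarkedGroupSpace n) :=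
  {p | ∃ (G : Type) (_ : Group G) (X : Fin n → G), Subgroup.closure (Set.range X) = ⊤ ∧
    p = MarkedGroupSpace.mk G X ∧ IsHyperbolicGroup G ∧ ¬ IsVirtuallyCyclicGroup G}

/-- The measure `μ` is invariant under the action of `Γ`: `μ (gA) = μ A` for all `g` in `Γ` and
all measurable `A`. -/
def IsInvariantMeasure (Γ : Type*) {X : Type*} [Group Γ] [MulAction Γ X] [MeasurableSpace X]
    (μ : MeasureTheory.Measure X) : Prop :=
  ∀ g : Γ, ∀ A : Set X, MeasurableSet A → μ (g • A) = μ A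

/-- Every measurable set that is invariant under the action of `Γ` has measure `0` or `1`: this is
ergodicity of an invariant probability measure `μ`. -/
def IsErgodicMeasure (Γ : Type*) {X : Type*} [Group Γ] [MulAction Γ X] [MeasurableSpace X]
    (μ : MeasureTheory.Measure X) : Prop :=
  ∀ A : Set X, MeasurableSet A → (∀ g : Γ, g • A = A) → μ A = 0 ∨ μ A = 1

end

/-! Having no quotient of order 2 is an invariant property of a group, and it is open in the space
of marked groups: only finitely many characters of `F_n` have to be excluded, each by one relation.
If the support contains all hyperbolic points, this open set `withoutSigns` has positive measure,
since it contains `Z/5 * Z/5`; by ergodicity it has measure 1.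

It misses a second open set of positive measure. Let an element `a` of order 3 be inverted by one
generator and centralized by the others. Then the action by conjugation on `⟨a⟩` is a surjection of
the group onto `{1, -1}`, yet finitely many relations and one non-relation express the condition.
Such a set, `invertedBy`, contains a marking of `S_3 × (Z/5 * Z/5)`, which is hyperbolic because its
projection to the free product has finite kernel. This is the contradiction.

The order 5 is odd, which rules out signs; it exceeds 2, which the proof of not being virtually
cyclic needs; and it is coprime to 6, so two elements generate the product. Hyperbolicity comes from
a four-point inequality for syllable length. -/

open scoped Pointwise

/-! ### Common prefixes of words. -/

namespace List

/-- The length of the longest common prefix of two lists. -/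
def commonPrefixLength {α : Type*} [DecidableEq α] : List α → List α → ℕ
  | a :: l, b :: m => if a = b then commonPrefixLength l m + 1 else 0
  | _, _ => 0

variable {α : Type*} [DecidableEq α]

/-- The ultrametric inequality of a tree of words; it is the source of hyperbolicity. -/
theorem min_commonPrefixLength_le (l m k : List α) :
    min (commonPrefixLength l k) (commonPrefixLength m k) ≤ commonPrefixLength l m := by
  induction l generalizing m k with
  | nil => simp [commonPrefixLength]
  | cons a l ih =>
    cases k with
    | nil => simp [commonPrefixLength]
    | cons c k =>
      cases m with
      | nil => simp [commonPrefixLength]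
      | cons b m =>
        have := ih m k
        by_cases h1 : a = c <;> by_cases h2 : b = c
        · subst h1 h2
          simp only [commonPrefixLength, if_true]
          omega
        all_goals simp [commonPrefixLength, h1, h2]

end List

/-! ### Syllable length in free products. -/

namespace Monoid.CoprodI

open Classical in
/-- The syllable length of an element of a free product. -/
noncomputable def syllableLength {ι : Type*} {M : ι → Type*} [∀ i, Monoid (M i)]
    (g : CoprodI M) : ℕ :=
  (Word.equiv g).toList.length

/-- The product in the free product of a list of letters. -/
def listProd {ι : Type*} {M : ι → Type*} [∀ i, Monoid (M i)] (L : List (Σ i, M i)) : CoprodI M :=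
  (L.map fun l => of l.2).prod

/-- A list of letters is reduced if it underlies a `Word`. -/
def IsReduced {ι : Type*} {M : ι → Type*} [∀ i, Monoid (M i)] (L : List (Σ i, M i)) : Prop :=
  (∀ l ∈ L, l.2 ≠ 1) ∧ L.IsChain fun a b => a.1 ≠ b.1

section Monoid

variable {ι : Type*} {M : ι → Type*} [∀ i, Monoid (M i)]

@[simp] theorem listProd_nil : listProd ([] : List (Σ i, M i)) = 1 := rfl

@[simp] theorem listProd_cons (a : Σ i, M i) (L : List (Σ i, M i)) :
    listProd (a :: L) = of a.2 * listProd L := by simp [listProd]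

@[simp] theorem listProd_append (L K : List (Σ i, M i)) :
    listProd (L ++ K) = listProd L * listProd K := by simp [listProd]

theorem isReduced_nil : IsReduced ([] : List (Σ i, M i)) := by simp [IsReduced]

theorem IsReduced.tail {a : Σ i, M i} {L : List (Σ i, M i)} (h : IsReduced (a :: L)) :
    IsReduced L :=
  ⟨fun l hl => h.1 l (List.mem_cons_of_mem _ hl), h.2.tail⟩

theorem syllableLength_listProd {L : List (Σ i, M i)} (hL : IsReduced L) :
    syllableLength (listProd L) = L.length := by
  classical
  have h : listProd L = Word.equiv.symm ⟨L, hL.1, hL.2⟩ := rfl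
  rw [syllableLength, h]
  convert congrArg (fun w => (Word.toList w).length) (Word.equiv.apply_symm_apply _)

theorem exists_isReduced (g : CoprodI M) : ∃ L, IsReduced L ∧ listProd L = g := by
  classical
  exact ⟨(Word.equiv g).toList, ⟨(Word.equiv g).ne_one, (Word.equiv g).chain_ne⟩,
    Word.equiv.symm_apply_apply g⟩

theorem syllableLength_of_mul_le {i : ι} (m : M i) (g : CoprodI M) :
    syllableLength (of m * g) ≤ syllableLength g + 1 := by
  obtain ⟨L, hL, rfl⟩ := exists_isReduced g
  rw [syllableLength_listProd hL]
  by_cases hm : m = 1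
  · simp [hm, syllableLength_listProd hL]
  by_cases hi : ∀ b ∈ L.head?, i ≠ b.1
  · have h : IsReduced (⟨i, m⟩ :: L) :=
      ⟨by simpa [hm] using hL.1, List.isChain_cons.2 ⟨hi, hL.2⟩⟩
    have := syllableLength_listProd h
    simp only [listProd_cons, List.length_cons] at this
    exact this.le
  · push Not at hi
    obtain ⟨⟨j, b⟩, hb, rfl⟩ := hi
    cases L with
    | nil => simp at hb
    | cons c L =>
      obtain rfl : c = ⟨i, b⟩ := by simpa using hb
      have hc : of m * listProd (⟨i, b⟩ :: L) = of (m * b) * listProd L := by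
        simp [mul_assoc]
      rw [hc]
      by_cases h1 : m * b = 1
      · simp [h1, syllableLength_listProd hL.tail]
        omega
      · have h : IsReduced (⟨i, m * b⟩ :: L) :=
          ⟨by simpa [h1] using hL.tail.1,
            List.isChain_cons.2 ⟨(List.isChain_cons.1 hL.2).1, hL.2.tail⟩⟩
        have := syllableLength_listProd h
        simp only [listProd_cons, List.length_cons] at this
        rw [this]
        simp

theorem syllableLength_listProd_mul_le (L : List (Σ i, M i)) (g : CoprodI M) :
    syllableLength (listProd L * g) ≤ L.length + syllableLength g := by
  induction L with
  | nil => simp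
  | cons a L ih =>
    have := syllableLength_of_mul_le a.2 (listProd L * g)
    rw [listProd_cons, mul_assoc, List.length_cons]
    omega

theorem syllableLength_mul_le (g h : CoprodI M) :
    syllableLength (g * h) ≤ syllableLength g + syllableLength h := by
  obtain ⟨L, hL, rfl⟩ := exists_isReduced g
  rw [syllableLength_listProd hL]
  exact syllableLength_listProd_mul_le L h

@[simp] theorem syllableLength_one : syllableLength (1 : CoprodI M) = 0 :=
  syllableLength_listProd (isReduced_nil (M := M))

theorem syllableLength_of_le {i : ι} (m : M i) : syllableLength (of m) ≤ 1 := by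
  simpa using syllableLength_of_mul_le m (1 : CoprodI M)

theorem finite_syllableLength_le_one [Finite ι] [∀ i, Finite (M i)] :
    {g : CoprodI M | syllableLength g ≤ 1}.Finite := by
  refine ((Set.finite_range fun a : Σ i, M i => (of a.2 : CoprodI M)).union
    (Set.finite_singleton 1)).subset fun g hg => ?_
  obtain ⟨L, hL, rfl⟩ := exists_isReduced g
  rw [Set.mem_ofPred_eq, syllableLength_listProd hL] at hg
  match L, hg with
  | [], _ => right; simp
  | [a], _ => left; exact ⟨a, by simp⟩

end Monoid

section Group

variable {ι : Type*} {H : ι → Type*} [∀ i, Group (H i)]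

/-- The list of the inverses of the letters, in the reverse order. -/
def invList (L : List (Σ i, H i)) : List (Σ i, H i) :=
  (L.map fun a => ⟨a.1, a.2⁻¹⟩).reverse

@[simp] theorem invList_cons (a : Σ i, H i) (L : List (Σ i, H i)) :
    invList (a :: L) = invList L ++ [⟨a.1, a.2⁻¹⟩] := by simp [invList]

@[simp] theorem length_invList (L : List (Σ i, H i)) : (invList L).length = L.length := by
  simp [invList]

theorem listProd_invList (L : List (Σ i, H i)) : listProd (invList L) = (listProd L)⁻¹ := by
  induction L with
  | nil => simp [invList]
  | cons a L ih => simp [ih]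

theorem IsReduced.invList {L : List (Σ i, H i)} (h : IsReduced L) : IsReduced (invList L) := by
  refine ⟨?_, ?_⟩
  · simp only [CoprodI.invList, List.mem_reverse, List.mem_map, ne_eq, forall_exists_index, and_imp]
    rintro _ a ha rfl
    simpa using h.1 a ha
  · rw [CoprodI.invList, List.isChain_reverse, List.isChain_map]
    exact h.2.imp fun _ _ hab => hab.symm

theorem IsReduced.invList_append {L K : List (Σ i, H i)} (hL : IsReduced L) (hK : IsReduced K)
    (h : ∀ a ∈ L.head?, ∀ b ∈ K.head?, a.1 ≠ b.1) : IsReduced (CoprodI.invList L ++ K) := by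
  refine ⟨fun l hl => ?_, List.isChain_append.2 ⟨hL.invList.2, hK.2, ?_⟩⟩
  · rcases List.mem_append.1 hl with hl | hl
    exacts [hL.invList.1 l hl, hK.1 l hl]
  · intro x hx
    cases L with
    | nil => simp [CoprodI.invList] at hx
    | cons a L =>
      simp only [invList_cons, List.getLast?_concat, Option.mem_def, Option.some.injEq] at hx
      subst hx
      exact h a (by simp)

open Classical in
-- The common prefix cancels completely. After it, the first letters either lie in different factors
-- and nothing more happens, or lie in one factor and merge into a single nontrivial letter, which
-- costs one syllable. So the common prefix length is the Gromov product up to 1/2.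
theorem syllableLength_inv_mul {L K : List (Σ i, H i)} (hL : IsReduced L) (hK : IsReduced K) :
    syllableLength ((listProd L)⁻¹ * listProd K) + 2 * L.commonPrefixLength K
        ≤ L.length + K.length ∧
      L.length + K.length
        ≤ syllableLength ((listProd L)⁻¹ * listProd K) + 2 * L.commonPrefixLength K + 1 := by
  have disj : ∀ {L K : List (Σ i, H i)}, IsReduced L → IsReduced K →
      (∀ a ∈ L.head?, ∀ b ∈ K.head?, a.1 ≠ b.1) →
      syllableLength ((listProd L)⁻¹ * listProd K) = L.length + K.length := by
    intro L K hL hK h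
    rw [← listProd_invList, ← listProd_append,
      syllableLength_listProd (hL.invList_append hK h)]
    simp
  induction L generalizing K with
  | nil => simp [List.commonPrefixLength, syllableLength_listProd hK]
  | cons a L ih =>
    cases K with
    | nil =>
      rw [disj hL hK (by simp)]
      simp [List.commonPrefixLength]
    | cons b K =>
      by_cases hab : a = b
      · subst hab
        have h1 := ih hL.tail hK.tail
        have h2 : (listProd (a :: L))⁻¹ * listProd (a :: K) = (listProd L)⁻¹ * listProd K := by
          simp [mul_assoc]
        rw [h2]
        simp only [List.commonPrefixLength, if_true, List.length_cons]
        omega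
      · by_cases hi : a.1 = b.1
        · obtain ⟨i, a⟩ := a
          obtain ⟨j, b⟩ := b
          obtain rfl : i = j := hi
          have hne : a⁻¹ * b ≠ 1 := fun h => hab (by rw [inv_mul_eq_one.1 h])
          have hred : IsReduced (⟨i, a⁻¹ * b⟩ :: K) :=
            ⟨by simpa [hne] using hK.tail.1,
              List.isChain_cons.2 ⟨(List.isChain_cons.1 hK.2).1, hK.2.tail⟩⟩
          have h := disj hL.tail hred (by
            intro x hx y hy
            obtain rfl : (⟨i, a⁻¹ * b⟩ : Σ i, H i) = y := by simpa using hy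
            exact ((List.isChain_cons.1 hL.2).1 x hx).symm)
          have h2 : (listProd (⟨i, a⟩ :: L))⁻¹ * listProd (⟨i, b⟩ :: K)
              = (listProd L)⁻¹ * listProd (⟨i, a⁻¹ * b⟩ :: K) := by
            simp [mul_assoc]
          rw [h2, h]
          simp only [List.commonPrefixLength, if_neg hab, List.length_cons]
          omega
        · rw [disj hL hK (by simpa using hi)]
          simp [List.commonPrefixLength, hab]

/-- A four-point condition for the syllable length in a free product. -/
theorem syllableLength_four_point (x y z w : CoprodI H) :
    syllableLength (x⁻¹ * y) + syllableLength (z⁻¹ * w) ≤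
      max (syllableLength (x⁻¹ * z) + syllableLength (y⁻¹ * w))
        (syllableLength (x⁻¹ * w) + syllableLength (y⁻¹ * z)) + 1 := by
  classical
  -- With `w` moved to the identity, distances to `w` are word lengths and the prefix inequality
  -- compares Gromov products based at `w`.
  obtain ⟨X, hX, hx⟩ := exists_isReduced (w⁻¹ * x)
  obtain ⟨Y, hY, hy⟩ := exists_isReduced (w⁻¹ * y)
  obtain ⟨Z, hZ, hz⟩ := exists_isReduced (w⁻¹ * z)
  have key : ∀ {A : List (Σ i, H i)} {a : CoprodI H}, IsReduced A → listProd A = w⁻¹ * a →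
      syllableLength (a⁻¹ * w) = A.length := by
    intro A a hA ha
    rw [← length_invList, ← syllableLength_listProd hA.invList, listProd_invList, ha]
    simp
  have h1 := syllableLength_inv_mul hX hY
  have h2 := syllableLength_inv_mul hX hZ
  have h3 := syllableLength_inv_mul hY hZ
  have h4 := List.min_commonPrefixLength_le X Y Z
  have e : ∀ a b : CoprodI H, (w⁻¹ * a)⁻¹ * (w⁻¹ * b) = a⁻¹ * b := fun a b => by group
  rw [hx, hy, e] at h1
  rw [hx, hz, e] at h2
  rw [hy, hz, e] at h3
  rw [key hX hx, key hY hy, key hZ hz]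
  omega

end Group

end Monoid.CoprodI
-- Hyperbolicity of finite-kernel extensions of free products.
noncomputable section

namespace Monoid.CoprodI

variable {ι : Type*} {H : ι → Type*} [∀ i, Group (H i)]

theorem syllableLength_inv (g : CoprodI H) : syllableLength g⁻¹ = syllableLength g := by
  obtain ⟨L, hL, rfl⟩ := exists_isReduced g
  rw [← listProd_invList, syllableLength_listProd hL, syllableLength_listProd hL.invList,
    length_invList]

section Hyperbolic

variable {G : Type*} [Group G] (π : G →* CoprodI H)

theorem exists_walk_length_le_one (x : G) {s : G} (hs : syllableLength (π s) ≤ 1) :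
    ∃ p : (SimpleGraph.mulCayley {s : G | syllableLength (π s) ≤ 1}).Walk x (x * s),
      p.length ≤ 1 := by
  by_cases h : s = 1
  · subst h
    exact ⟨SimpleGraph.Walk.nil.copy rfl (mul_one x).symm, by simp⟩
  · have hadj : (SimpleGraph.mulCayley {s : G | syllableLength (π s) ≤ 1}).Adj x (x * s) := by
      rw [SimpleGraph.mulCayley_adj']
      exact ⟨by simpa using h, s, hs, Or.inl rfl⟩
    exact ⟨hadj.toWalk, by simp⟩

/-- Each letter lifts to one edge. The lifts may miss the endpoint by an element of the kernel of
`π`, which is itself in the connection set; this is the extra 1. -/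
theorem exists_walk_length_le (hπ : Function.Surjective π) (L : List (Σ i, H i)) (x g : G)
    (hg : π g = listProd L) :
    ∃ p : (SimpleGraph.mulCayley {s : G | syllableLength (π s) ≤ 1}).Walk x (x * g),
      p.length ≤ L.length + 1 := by
  induction L generalizing x g with
  | nil => exact exists_walk_length_le_one π x (by simp [hg])
  | cons a L ih =>
    obtain ⟨s, hs⟩ := hπ (of a.2)
    obtain ⟨p, hp⟩ := exists_walk_length_le_one π x (s := s) (hs ▸ syllableLength_of_le a.2)
    obtain ⟨q, hq⟩ := ih (x * s) (s⁻¹ * g) (by simp [hs, hg])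
    refine ⟨p.append (q.copy rfl (by group)), ?_⟩
    simp only [SimpleGraph.Walk.length_append, SimpleGraph.Walk.length_copy, List.length_cons]
    omega

theorem syllableLength_le_length {x y : G}
    (p : (SimpleGraph.mulCayley {s : G | syllableLength (π s) ≤ 1}).Walk x y) :
    syllableLength (π (x⁻¹ * y)) ≤ p.length := by
  induction p with
  | nil => simp
  | @cons u v w h p ih =>
    have h1 : syllableLength (π (u⁻¹ * v)) ≤ 1 := by
      obtain ⟨-, s, hs, rfl | rfl⟩ := (SimpleGraph.mulCayley_adj' _ _ _).1 h
      · simpa using hs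
      · simpa [syllableLength_inv] using hs
    have h2 : u⁻¹ * w = (u⁻¹ * v) * (v⁻¹ * w) := by group
    have h3 := syllableLength_mul_le (π (u⁻¹ * v)) (π (v⁻¹ * w))
    rw [h2, map_mul, SimpleGraph.Walk.length_cons]
    omega

/-- The word distance for the preimage of the set of elements of syllable length at most `1` is,
up to an error of `1`, the syllable length of the image. -/
theorem wordDist_bounds (hπ : Function.Surjective π) (x y : G) :
    syllableLength ((π x)⁻¹ * π y) ≤ wordDist {s : G | syllableLength (π s) ≤ 1} x y ∧
      wordDist {s : G | syllableLength (π s) ≤ 1} x y ≤ syllableLength ((π x)⁻¹ * π y) + 1 := by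
  obtain ⟨L, hL, hLg⟩ := exists_isReduced ((π x)⁻¹ * π y)
  obtain ⟨p, hp⟩ := exists_walk_length_le π hπ L x (x⁻¹ * y) (by simp [hLg])
  have p' := p.copy rfl (mul_inv_cancel_left x y)
  constructor
  · obtain ⟨q, hq⟩ := p'.reachable.exists_walk_length_eq_dist
    have := syllableLength_le_length π q
    rw [map_mul, map_inv, hq] at this
    exact this
  · rw [← hLg, syllableLength_listProd hL]
    refine le_trans ?_ hp
    rw [← SimpleGraph.Walk.length_copy p rfl (mul_inv_cancel_left x y)]
    exact SimpleGraph.dist_le _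

/-- A group that maps with finite kernel onto a free product of finitely many finite groups is
hyperbolic. -/
theorem isHyperbolicGroup_of_surjective [Finite ι] [∀ i, Finite (H i)]
    (hπ : Function.Surjective π) (hfin : ∀ q, (π ⁻¹' {q}).Finite) : IsHyperbolicGroup G := by
  -- The constant 3 is 1 from `syllableLength_four_point` plus an error of 1 for each of the two
  -- distances on the left.
  refine ⟨{s : G | syllableLength (π s) ≤ 1}, ?_, ?_, 3, fun x y z w => ?_⟩
  · exact (finite_syllableLength_le_one (M := H)).preimage' fun q _ => hfin q
  · rw [eq_top_iff]
    have key : ∀ (L : List (Σ i, H i)) (g : G), π g = listProd L →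
        g ∈ Subgroup.closure {s : G | syllableLength (π s) ≤ 1} := by
      intro L
      induction L with
      | nil => exact fun g hg => Subgroup.subset_closure (by simp [hg])
      | cons a L ih =>
        intro g hg
        obtain ⟨s, hs⟩ := hπ (of a.2)
        have h1 := ih (s⁻¹ * g) (by simp [hs, hg])
        have h2 : s ∈ Subgroup.closure {s : G | syllableLength (π s) ≤ 1} :=
          Subgroup.subset_closure (hs ▸ syllableLength_of_le a.2 : syllableLength (π s) ≤ 1)
        simpa using mul_mem h2 h1
    intro g _
    obtain ⟨L, -, hL⟩ := exists_isReduced (π g)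
    exact key L g hL.symm
  · have h := syllableLength_four_point (π x) (π y) (π z) (π w)
    have h1 := wordDist_bounds π hπ x y
    have h2 := wordDist_bounds π hπ z w
    have h3 := wordDist_bounds π hπ x z
    have h4 := wordDist_bounds π hπ y w
    have h5 := wordDist_bounds π hπ x w
    have h6 := wordDist_bounds π hπ y z
    omega

end Hyperbolic

/-! ### Free products that are not virtually cyclic. -/

section VirtuallyCyclic

/-- The reduced word of `g` is non-empty, begins with a letter of `H i` and ends with a letter
of `H j`. -/
def HasEnds (i j : ι) (g : CoprodI H) : Prop := ∃ w : NeWord H i j, w.prod = g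

theorem hasEnds_of {i : ι} {m : H i} (hm : m ≠ 1) : HasEnds i i (of m) :=
  ⟨.singleton m hm, NeWord.prod_singleton m hm⟩

theorem HasEnds.mul {i j k l : ι} {g h : CoprodI H} (hg : HasEnds i j g) (hjk : j ≠ k)
    (hh : HasEnds k l h) : HasEnds i l (g * h) := by
  obtain ⟨u, rfl⟩ := hg
  obtain ⟨v, rfl⟩ := hh
  exact ⟨.append u hjk v, NeWord.append_prod⟩

theorem HasEnds.fst_eq {i j k l : ι} {g : CoprodI H} (h : HasEnds i j g) (h' : HasEnds k l g) :
    i = k := by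
  classical
  obtain ⟨u, hu⟩ := h
  obtain ⟨v, hv⟩ := h'
  have huv : u.toWord = v.toWord := Word.equiv.symm.injective (hu.trans hv.symm)
  have hl : u.toList = v.toList := congrArg Word.toList huv
  have := u.toList_head?
  rw [hl, v.toList_head?] at this
  simp only [Option.some.injEq] at this
  exact (congrArg Sigma.fst this).symm

/-- Where consecutive copies of `a g a` meet, the letters merge into `a * a`, which is nontrivial,
so cancellation never reaches the ends. -/
theorem HasEnds.pow_conj {i j : ι} (hij : i ≠ j) {a : H i} (ha : a ≠ 1) (haa : a * a ≠ 1)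
    {g : CoprodI H} (hg : HasEnds j j g) {k : ℕ} (hk : 0 < k) :
    HasEnds i i ((of a * g * of a) ^ k) := by
  have key : ∀ k : ℕ, ∃ t, HasEnds j j t ∧ (of a * g * of a) ^ (k + 1) = of a * t * of a := by
    intro k
    induction k with
    | zero => exact ⟨g, hg, by simp⟩
    | succ k ih =>
      obtain ⟨t, ht, hk⟩ := ih
      refine ⟨t * of (a * a) * g, (ht.mul hij.symm (hasEnds_of haa)).mul hij hg, ?_⟩
      rw [pow_succ, hk, map_mul]
      group
  obtain ⟨k, rfl⟩ := Nat.exists_eq_succ_of_ne_zero hk.ne'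
  obtain ⟨t, ht, h⟩ := key k
  rw [Nat.succ_eq_add_one, h]
  exact ((hasEnds_of ha).mul hij ht).mul hij.symm (hasEnds_of ha)

/-- A group that maps onto a free product with two factors that contain elements of order greater
than `2` is not virtually cyclic. -/
theorem not_isVirtuallyCyclicGroup_of_surjective {G : Type*} [Group G] (π : G →* CoprodI H)
    (hπ : Function.Surjective π) {i j : ι} (hij : i ≠ j) {a : H i} {b : H j} (ha : a ≠ 1)
    (haa : a * a ≠ 1) (hb : b ≠ 1) (hbb : b * b ≠ 1) : ¬ IsVirtuallyCyclicGroup G := by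
  rintro ⟨C, hC, hfin⟩
  obtain ⟨u, hu⟩ := hπ (of a * of b * of a)
  obtain ⟨v, hv⟩ := hπ (of b * of a * of b)
  obtain ⟨k, hk, -, hkC⟩ := Subgroup.exists_pow_mem_of_index_ne_zero hfin.index_ne_zero u
  obtain ⟨l, hl, -, hlC⟩ := Subgroup.exists_pow_mem_of_index_ne_zero hfin.index_ne_zero v
  -- Powers in the cyclic subgroup commute, but the images of the two products have reduced words
  -- that begin in different factors.
  have hcomm : u ^ k * v ^ l = v ^ l * u ^ k :=
    congrArg Subtype.val (IsCyclic.isMulCommutative.is_comm.comm (⟨_, hkC⟩ : C) ⟨_, hlC⟩)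
  have h := congrArg π hcomm
  simp only [map_mul, map_pow, hu, hv] at h
  have h1 := HasEnds.pow_conj hij ha haa (hasEnds_of hb) hk
  have h2 := HasEnds.pow_conj hij.symm hb hbb (hasEnds_of ha) hl
  exact hij ((h1.mul hij h2).fst_eq (h ▸ h2.mul hij.symm h1))

end VirtuallyCyclic

theorem subgroup_eq_top (K : Subgroup (CoprodI H)) (h : ∀ i (m : H i), of m ∈ K) : K = ⊤ := by
  rw [eq_top_iff]
  intro g _
  induction g using induction_left with
  | one => exact K.one_mem
  | mul m x hx => exact K.mul_mem (h _ m) (hx trivial)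

end Monoid.CoprodI

/-! ### Two disjoint open sets of marked groups. -/

open Monoid

namespace MarkedGroupSpace

variable {n : ℕ}

theorem isOpen_setOf_mem (w : FreeGp n) : IsOpen {N : MarkedGroupSpace n | w ∈ N.1} := by
  have h : {N : MarkedGroupSpace n | w ∈ N.1} = indicator ⁻¹' ((fun f => f w) ⁻¹' {true}) := by
    ext N
    simp [indicator]
  rw [h]
  exact ((isOpen_discrete _).preimage (continuous_apply w)).preimage continuous_induced_dom

theorem isOpen_setOf_notMem (w : FreeGp n) : IsOpen {N : MarkedGroupSpace n | w ∉ N.1} := by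
  have h : {N : MarkedGroupSpace n | w ∉ N.1} = indicator ⁻¹' ((fun f => f w) ⁻¹' {false}) := by
    ext N
    simp [indicator]
  rw [h]
  exact ((isOpen_discrete _).preimage (continuous_apply w)).preimage continuous_induced_dom

theorem mem_mk {G : Type*} [Group G] (X : Fin n → G) (w : FreeGp n) :
    w ∈ (mk G X).1 ↔ FreeGroup.lift X w = 1 := MonoidHom.mem_ker

/-- The set of marked groups without non-trivial homomorphisms to the group of order `2`. -/
def withoutSigns (n : ℕ) : Set (MarkedGroupSpace n) :=
  {N | ∀ χ : FreeGp n →* ℤˣ, χ ≠ 1 → ∃ w ∈ N.1, χ w ≠ 1}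

theorem isOpen_withoutSigns : IsOpen (withoutSigns n) := by
  have : Finite (FreeGp n →* ℤˣ) := Finite.of_equiv _ (FreeGroup.lift (α := Fin n) (β := ℤˣ))
  have h : withoutSigns n = ⋂ χ : FreeGp n →* ℤˣ, {N | χ ≠ 1 → ∃ w ∈ N.1, χ w ≠ 1} := by
    ext N
    simp [withoutSigns]
  rw [h]
  refine isOpen_iInter_of_finite fun χ => ?_
  by_cases hχ : χ = 1
  · simp [hχ]
  · have h' : {N : MarkedGroupSpace n | χ ≠ 1 → ∃ w ∈ N.1, χ w ≠ 1}
        = ⋃ w ∈ {w : FreeGp n | χ w ≠ 1}, {N | w ∈ N.1} := by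
      ext N
      simp [hχ, and_comm]
    rw [h']
    exact isOpen_biUnion fun w _ => isOpen_setOf_mem w

theorem smul_mem_withoutSigns (g : OutAut (FreeGp n)) {N : MarkedGroupSpace n}
    (hN : N ∈ withoutSigns n) : g • N ∈ withoutSigns n := by
  obtain ⟨φ, rfl⟩ := QuotientGroup.mk_surjective g
  rw [out_smul_eq]
  intro χ hχ
  obtain ⟨w, hw, hw1⟩ := hN (χ.comp φ.toMonoidHom) fun h => hχ <| by
    ext w
    have := DFunLike.congr_fun h (φ⁻¹ (FreeGroup.of w))
    simpa using congrArg Units.val this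
  exact ⟨φ w, (mem_smul_iff φ N _).2 (by simpa using hw), hw1⟩

theorem smul_withoutSigns (g : OutAut (FreeGp n)) : g • withoutSigns n = withoutSigns n := by
  ext N
  rw [Set.mem_smul_set_iff_inv_smul_mem]
  exact ⟨fun h => by simpa using smul_mem_withoutSigns g h, smul_mem_withoutSigns g⁻¹⟩

/-- A character to `{1, -1}` that factors through the group is trivial on elements of odd order,
hence on all generators. -/
theorem mk_mem_withoutSigns {G : Type*} [Group G] (X : Fin n → G)
    (hX : ∀ i, ∃ k, Odd k ∧ X i ^ k = 1) : mk G X ∈ withoutSigns n := by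
  intro χ hχ
  by_contra! h
  refine hχ (FreeGroup.ext_hom _ _ fun i => ?_)
  obtain ⟨k, ⟨m, rfl⟩, hki⟩ := hX i
  have := h (FreeGroup.of i ^ (2 * m + 1)) ((mem_mk X _).2 (by simpa using hki))
  rw [map_pow, pow_succ, pow_mul, Int.units_sq, one_pow, one_mul] at this
  simpa using this

/-- The set of marked groups in which `a` has order `3`, is inverted by the generator `j`, and the
generators other than `j` commute with it. -/
def invertedBy (a : FreeGp n) (j : Fin n) : Set (MarkedGroupSpace n) :=
  {N | a ∉ N.1 ∧ a ^ 3 ∈ N.1 ∧ FreeGroup.of j * a * (FreeGroup.of j)⁻¹ * a ∈ N.1 ∧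
    ∀ i, i ≠ j → FreeGroup.of i * a * (FreeGroup.of i)⁻¹ * a⁻¹ ∈ N.1}

theorem isOpen_invertedBy (a : FreeGp n) (j : Fin n) : IsOpen (invertedBy a j) := by
  have h : invertedBy a j = {N | a ∉ N.1} ∩ ({N | a ^ 3 ∈ N.1} ∩
      ({N | FreeGroup.of j * a * (FreeGroup.of j)⁻¹ * a ∈ N.1} ∩
        ⋂ i, {N | i ≠ j → FreeGroup.of i * a * (FreeGroup.of i)⁻¹ * a⁻¹ ∈ N.1})) := by
    ext N
    simp [invertedBy]
  rw [h]
  refine (isOpen_setOf_notMem _).inter ((isOpen_setOf_mem _).inter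
    ((isOpen_setOf_mem _).inter (isOpen_iInter_of_finite fun i => ?_)))
  by_cases hi : i = j
  · simp [hi]
  · simpa [hi] using isOpen_setOf_mem _

/-- Conjugation by `g` raises `a` to the power `χ g`, where `χ` is -1 on generator `j` and 1 on the
others. A relation `w` with `χ w = -1` would give `a = a⁻¹`, which with `a ^ 3 = 1` forces `a = 1`.
So `χ` descends to the quotient. -/
theorem disjoint_invertedBy_withoutSigns (a : FreeGp n) (j : Fin n) :
    Disjoint (invertedBy a j) (withoutSigns n) := by
  rw [Set.disjoint_left]
  rintro N ⟨ha, ha3, hj, hi⟩ hN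
  have := N.2
  let q := QuotientGroup.mk' N.1
  have hq : ∀ w, q w = 1 ↔ w ∈ N.1 := fun w => QuotientGroup.eq_one_iff w
  let χ : FreeGp n →* ℤˣ := FreeGroup.lift fun i => if i = j then -1 else 1
  have hχ : χ ≠ 1 := fun h => by
    have := DFunLike.congr_fun h (FreeGroup.of j)
    simp [χ] at this
  obtain ⟨w, hw, hw1⟩ := hN χ hχ
  have hof : ∀ i, q (FreeGroup.of i) * q a * (q (FreeGroup.of i))⁻¹
      = q a ^ ((χ (FreeGroup.of i) : ℤˣ) : ℤ) := by
    intro i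
    by_cases hij : i = j
    · subst hij
      have := (hq _).2 hj
      simp only [map_mul, map_inv] at this
      simpa [χ] using eq_inv_of_mul_eq_one_left this
    · have := (hq _).2 (hi i hij)
      simp only [map_mul, map_inv] at this
      simpa [χ, hij] using eq_of_mul_inv_eq_one this
  have key : ∀ g, q g * q a * (q g)⁻¹ = q a ^ ((χ g : ℤˣ) : ℤ) := by
    intro g
    induction g using FreeGroup.induction_on with
    | C1 => simp
    | of i => exact hof i
    | inv_of i h =>
      -- The sign is its own inverse, so raising the relation for the generator to that power and
      -- conjugating back gives the relation for its inverse.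
      have h' := congrArg (fun x => (q (FreeGroup.of i))⁻¹ * x ^ ((χ (FreeGroup.of i) : ℤˣ) : ℤ)
        * q (FreeGroup.of i)) (hof i)
      simp only [← zpow_mul, ← Units.val_mul, Int.units_mul_self, Units.val_one, zpow_one] at h'
      rw [conj_zpow] at h'
      simp only [map_inv, Int.units_inv_eq_self, inv_inv, ← h']
      group
    | mul x y hx hy =>
      have h' : q (x * y) * q a * (q (x * y))⁻¹ = q x * (q y * q a * (q y)⁻¹) * (q x)⁻¹ := by
        rw [map_mul]
        group
      rw [h', hy, ← conj_zpow, hx, ← zpow_mul, map_mul, Units.val_mul]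
  have h1 := key w
  rw [(hq w).2 hw, (Int.units_eq_one_or (χ w)).resolve_left hw1] at h1
  simp only [one_mul, inv_one, mul_one, Units.val_neg, Units.val_one, zpow_neg, zpow_one] at h1
  have h3 := (hq _).2 ha3
  rw [map_pow, pow_succ, pow_two, mul_eq_one_iff_eq_inv.2 h1, one_mul] at h3
  exact ha ((hq a).1 h3)

/-- The tuple `(p, q, 1, …, 1)`. -/
def pairTuple {G : Type*} [Group G] (n : ℕ) (p q : G) (i : Fin n) : G :=
  if i.val = 0 then p else if i.val = 1 then q else 1

theorem closure_pairTuple {G : Type*} [Group G] (hn : 2 ≤ n) (p q : G) :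
    Subgroup.closure (Set.range (pairTuple n p q)) = Subgroup.closure {p, q} := by
  apply le_antisymm
  · rw [Subgroup.closure_le]
    rintro _ ⟨i, rfl⟩
    unfold pairTuple
    split_ifs
    · exact Subgroup.subset_closure (by simp)
    · exact Subgroup.subset_closure (by simp)
    · exact one_mem _
  · apply Subgroup.closure_mono
    rintro _ (rfl | rfl)
    · exact ⟨⟨0, by omega⟩, by simp [pairTuple]⟩
    · exact ⟨⟨1, by omega⟩, by simp [pairTuple]⟩

end MarkedGroupSpace

/-! ### The two hyperbolic witnesses. -/

/-- The free product of two groups of order `5`. -/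
abbrev FreeProductFive : Type := CoprodI fun _ : Fin 2 => Multiplicative (ZMod 5)

namespace FreeProductFive

/-- The standard generator of a factor. -/
def gen (i : Fin 2) : FreeProductFive :=
  CoprodI.of (M := fun _ : Fin 2 => Multiplicative (ZMod 5)) (i := i) (Multiplicative.ofAdd 1)

theorem gen_pow_five (i : Fin 2) : gen i ^ 5 = 1 := by
  have h : (Multiplicative.ofAdd (1 : ZMod 5)) ^ 5 = 1 := by decide
  rw [gen, ← map_pow, h, map_one]

theorem subgroup_eq_top (K : Subgroup FreeProductFive) (h : ∀ i, gen i ∈ K) : K = ⊤ := by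
  refine CoprodI.subgroup_eq_top K fun i m => ?_
  have hm : ∀ m : Multiplicative (ZMod 5), ∃ k : Fin 5, m = Multiplicative.ofAdd 1 ^ k.val := by
    decide
  obtain ⟨k, rfl⟩ := hm m
  rw [map_pow]
  exact K.pow_mem (h i) _

theorem not_isVirtuallyCyclicGroup_of_surjective {G : Type*} [Group G] (π : G →* FreeProductFive)
    (hπ : Function.Surjective π) : ¬ IsVirtuallyCyclicGroup G :=
  CoprodI.not_isVirtuallyCyclicGroup_of_surjective π hπ (i := 0) (j := 1) (by decide)
    (a := Multiplicative.ofAdd 1) (b := Multiplicative.ofAdd 1)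
    (by decide) (by decide) (by decide) (by decide)

theorem mk_mem_hyperbolicMarkedGroups {n : ℕ} {G : Type} [Group G] (X : Fin n → G)
    (hX : Subgroup.closure (Set.range X) = ⊤) (π : G →* FreeProductFive)
    (hπ : Function.Surjective π) (hfin : ∀ q, (π ⁻¹' {q}).Finite) :
    MarkedGroupSpace.mk G X ∈ hyperbolicMarkedGroups n := by
  have : ∀ i : Fin 2, Finite ((fun _ : Fin 2 => Multiplicative (ZMod 5)) i) := fun _ =>
    inferInstanceAs (Finite (ZMod 5))
  exact ⟨G, inferInstance, X, hX, rfl, CoprodI.isHyperbolicGroup_of_surjective π hπ hfin,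
    not_isVirtuallyCyclicGroup_of_surjective π hπ⟩

theorem closure_gen : Subgroup.closure {gen 0, gen 1} = ⊤ := by
  refine subgroup_eq_top _ fun i => Subgroup.subset_closure ?_
  fin_cases i <;> simp

end FreeProductFive

open MarkedGroupSpace FreeProductFive

theorem exists_mem_withoutSigns (n : ℕ) (hn : 2 ≤ n) :
    ∃ N ∈ hyperbolicMarkedGroups n, N ∈ withoutSigns n := by
  refine ⟨mk FreeProductFive (pairTuple n (gen 0) (gen 1)),
    mk_mem_hyperbolicMarkedGroups _ (by rw [closure_pairTuple hn, closure_gen]) (MonoidHom.id _)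
      Function.surjective_id fun q => Set.finite_singleton q,
    mk_mem_withoutSigns _ fun i => ⟨5, by decide, ?_⟩⟩
  unfold pairTuple
  split_ifs <;> simp [gen_pow_five]

/-- The orders 3 and 2 divide 6, and 6 is 1 modulo 5: sixth powers of the generators isolate their
free product components. The permutation components follow by division, and they generate `S_3`. -/
theorem closure_prod_eq_top :
    Subgroup.closure {((finRotate 3 : Equiv.Perm (Fin 3)), gen 0), (Equiv.swap 0 1, gen 1)}
      = ⊤ := by
  set K := Subgroup.closure
    {((finRotate 3 : Equiv.Perm (Fin 3)), gen 0), (Equiv.swap 0 1, gen 1)}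
  have h0 : ((finRotate 3 : Equiv.Perm (Fin 3)), gen 0) ∈ K := Subgroup.subset_closure (by simp)
  have h1 : ((Equiv.swap 0 1 : Equiv.Perm (Fin 3)), gen 1) ∈ K :=
    Subgroup.subset_closure (by simp)
  have g6 : ∀ i, gen i ^ 6 = gen i := fun i => by rw [pow_succ, gen_pow_five, one_mul]
  have g10 : ∀ i, gen i ^ 10 = 1 := fun i => by
    rw [show 10 = 5 * 2 from rfl, pow_mul, gen_pow_five, one_pow]
  have hQ : K.comap (MonoidHom.inr (Equiv.Perm (Fin 3)) FreeProductFive) = ⊤ := by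
    refine subgroup_eq_top _ fun i => ?_
    rw [Subgroup.mem_comap, MonoidHom.inr_apply]
    fin_cases i
    · have := K.pow_mem h0 6
      rwa [Prod.pow_mk, g6, show (finRotate 3 : Equiv.Perm (Fin 3)) ^ 6 = 1 by decide] at this
    · have := K.pow_mem h1 6
      rwa [Prod.pow_mk, g6, show (Equiv.swap 0 1 : Equiv.Perm (Fin 3)) ^ 6 = 1 by decide] at this
  have hQ' : ∀ g : FreeProductFive, ((1 : Equiv.Perm (Fin 3)), g) ∈ K := fun g => by
    have : g ∈ K.comap (MonoidHom.inr (Equiv.Perm (Fin 3)) FreeProductFive) := hQ ▸ trivial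
    simpa using this
  have hσ : ((finRotate 3 : Equiv.Perm (Fin 3)), (1 : FreeProductFive)) ∈ K := by
    simpa using K.mul_mem h0 (hQ' (gen 0)⁻¹)
  have hτ : ((Equiv.swap 0 1 : Equiv.Perm (Fin 3)), (1 : FreeProductFive)) ∈ K := by
    simpa using K.mul_mem h1 (hQ' (gen 1)⁻¹)
  have hS : ∀ p : Equiv.Perm (Fin 3), ∃ k l : Fin 3,
      p = finRotate 3 ^ k.val * Equiv.swap 0 1 ^ l.val := by decide
  rw [eq_top_iff]
  rintro ⟨p, g⟩ -
  obtain ⟨k, l, rfl⟩ := hS p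
  simpa using K.mul_mem (K.mul_mem (K.pow_mem hσ k) (K.pow_mem hτ l)) (hQ' g)

/-- Since 10 is 0 modulo 5 and 1 modulo 3, the tenth power of the first generator is the 3-cycle
alone. The transposition in the second generator inverts it. -/
theorem exists_mem_invertedBy (n : ℕ) (hn : 2 ≤ n) :
    ∃ N ∈ hyperbolicMarkedGroups n, N ∈ invertedBy (FreeGroup.of ⟨0, by omega⟩ ^ 10) ⟨1, hn⟩ := by
  have hfin : ∀ q : FreeProductFive,
      (MonoidHom.snd (Equiv.Perm (Fin 3)) FreeProductFive ⁻¹' {q}).Finite := fun q => by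
    refine (Set.finite_univ.prod (Set.finite_singleton q)).subset fun x hx => ?_
    simpa using hx
  have g10 : gen 0 ^ 10 = 1 := by
    rw [show 10 = 5 * 2 from rfl, pow_mul, gen_pow_five, one_pow]
  have s10 : (finRotate 3 : Equiv.Perm (Fin 3)) ^ 10 = finRotate 3 := by decide
  refine ⟨mk _ (pairTuple n ((finRotate 3 : Equiv.Perm (Fin 3)), gen 0) (Equiv.swap 0 1, gen 1)),
    mk_mem_hyperbolicMarkedGroups _ (by rw [closure_pairTuple hn, closure_prod_eq_top])
      (MonoidHom.snd _ _) (fun q => ⟨(1, q), rfl⟩) hfin, ?_, ?_, ?_, fun i hi => ?_⟩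
  · simp only [mem_mk, map_pow, FreeGroup.lift_apply_of, pairTuple, if_true, Prod.pow_mk, g10, s10]
    intro h
    exact absurd (congrArg Prod.fst h) (by decide)
  · simp only [mem_mk, map_pow, FreeGroup.lift_apply_of, pairTuple, if_true, Prod.pow_mk, g10, s10]
    exact Prod.ext (by decide) (by simp)
  · simp only [mem_mk, map_mul, map_inv, map_pow, FreeGroup.lift_apply_of, pairTuple, if_true,
      Prod.pow_mk, g10, s10, one_ne_zero, if_false]
    exact Prod.ext (by decide) (by simp)
  · have hi1 : i.val ≠ 1 := fun h => hi (Fin.ext h)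
    simp only [mem_mk, map_mul, map_inv, map_pow, FreeGroup.lift_apply_of, pairTuple, if_true,
      hi1, if_false]
    split_ifs <;> group

end

theorem corollary4p2 (n : ℕ) (hn : 2 ≤ n) :
    ¬ ∃ μ : MeasureTheory.Measure (MarkedGroupSpace n),
      MeasureTheory.IsProbabilityMeasure μ ∧
      IsInvariantMeasure (OutAut (FreeGp n)) μ ∧
      IsErgodicMeasure (OutAut (FreeGp n)) μ ∧
      hyperbolicMarkedGroups n ⊆ μ.support := by
  rintro ⟨μ, hμ, -, herg, hsupp⟩
  have hpos : ∀ {N : MarkedGroupSpace n} {A : Set (MarkedGroupSpace n)},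
      N ∈ hyperbolicMarkedGroups n → IsOpen A → N ∈ A → 0 < μ A := fun hN hA hNA =>
    (MeasureTheory.Measure.mem_support_iff_forall _).1 (hsupp hN) _ (hA.mem_nhds hNA)
  obtain ⟨N, hN, hNV⟩ := exists_mem_withoutSigns n hn
  obtain ⟨M, hM, hMU⟩ := exists_mem_invertedBy n hn
  have hopen := MarkedGroupSpace.isOpen_withoutSigns (n := n)
  -- The first witness excludes measure 0, so ergodicity gives measure 1; the second witness then
  -- lies in an open set inside the null complement.
  have hV := (herg _ hopen.measurableSet MarkedGroupSpace.smul_withoutSigns).resolve_left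
    (hpos hN hopen hNV).ne'
  refine (hpos hM (MarkedGroupSpace.isOpen_invertedBy _ _) hMU).ne'
    (MeasureTheory.measure_mono_null ?_
      ((MeasureTheory.prob_compl_eq_zero_iff hopen.measurableSet).2 hV))
  exact (MarkedGroupSpace.disjoint_invertedBy_withoutSigns _ _).subset_compl_right
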